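/- Let $\langle\cdot,\cdot\rangle$ be the scalar product of $L^2(\mathbb R)$, linear in the first argument, and let $T,D$ be the unitary operators $[Tf](x)=f(x-1)$, $[Df](x)=2^{1/2}f(2x)$ on $L^2(\mathbb R)$. Let $\{L_i^{(0)}\}_{i\in\mathbb I}$ be an orthonormal basis of $L^2[0,1)$ and, for each sign $s=\pm$, let $\{K_{s,l}^{(0)}\}_{l\in\mathbb J}$ be an orthonormal basis of $L^2[s1,s2)$ (that is, of $L^2[1,2)$ for $s=+$ and of $L^2(-2,-1]$ for $s=-$), all regarded as subspaces of $L^2(\mathbb R)$. For $n,m\in\mathbb Z$ put $$L_i^{(n)}:=T^nL_i^{(0)},\qquad K_{s,l}^{(m)}:=D^mK_{s,l}^{(0)},\qquad \alpha_{i,n}^{s,l,m}:=\langle L_i^{(n)},K_{s,l}^{(m)}\rangle,\qquad \hat f_i^{(n)}:=\langle f,L_i^{(n)}\rangle\quad(f\in L^2(\mathbb R)).$$ Let $\Psi$ be a finite or countable family in $L^2(\mathbb R)$ with $\sup_{\psi\in\Psi}\|\psi\|<\infty$, let $X=\{\psi_{k,j}:=D^kT^j\psi\}_{k,j\in\mathbb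 Z,\ \psi\in\Psi}$ be the wavelet system generated by $\Psi$ (a family indexed by the triplets $(k,j,\psi)$), and let $B>0$. The family $X$ is a *frame* if there are $A',B'>0$ with $A'\|f\|^2\le\sum_{k,j,\psi}|\langle f,\psi_{k,j}\rangle|^2\le B'\|f\|^2$ for all $f\in L^2(\mathbb R)$; it is a *tight frame with frame bound $B$* if it is a frame and the largest possible $A'$ and the smallest possible $B'$ are both equal to $B$. Then $X$ is a tight frame for $L^2(\mathbb R)$ with frame bound $B$ if and only if, for all $s,s'\in\{+,-\}$, $l,l'\in\mathbb J$ and $\sigma\in\mathbb Z$, $$\sum_{\substack{i,i'\in\mathbb I\\ n,n'\in\mathbb Z}}\Big({\sum_{k,j\in\mathbb Z}}^{u}\ \overline{\alpha_{i,n+j}^{s,l,k}}\;\alpha_{i',n'+j}^{s',l',k+\sigma}\Big)\Big({\sum_{\psi\in\Psi}}^{u}\ \overline{\hat\psi_i^{(n)}}\;\hat\psi_{i'}^{(n')}\Big)=B\,\delta_{s,s'}\,\delta_{l,l'}\,\delta_{\sigma,0}.\qquad(*)$$ Here the superscript $u$ (unconditional summation over the triplets $(k,j,\psi)$) means that $(*)$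 is understood as the limit, over finite sets of triplets directed by inclusion, of the corresponding sums: $(*)$ asserts that $$\lim_{F_1,F_2}\ \sum_{i,n,i',n'}\Big(\sum_{(k,j)\in F_1}\overline{\alpha_{i,n+j}^{s,l,k}}\,\alpha_{i',n'+j}^{s',l',k+\sigma}\Big)\Big(\sum_{\psi\in F_2}\overline{\hat\psi_i^{(n)}}\,\hat\psi_{i'}^{(n')}\Big)=B\,\delta_{s,s'}\delta_{l,l'}\delta_{\sigma,0},$$ where $F_1\subset\mathbb Z\times\mathbb Z$ and $F_2\subset\Psi$ range over the finite subsets. The same equivalence holds when the limit is taken over all finite sets $F\subset\mathbb Z\times\mathbb Z\times\Psi$ of triplets instead of the products $F_1\times F_2$, i.e. with $$\lim_{F}\ \sum_{i,n,i',n'}\ \sum_{(k,j,\psi)\in F}\overline{\alpha_{i,n+j}^{s,l,k}}\,\alpha_{i',n'+j}^{s',l',k+\sigma}\,\overline{\hat\psi_i^{(n)}}\,\hat\psi_{i'}^{(n')}=B\,\delta_{s,s'}\delta_{l,l'}\delta_{\sigma,0}.$$ For each single triplet $(k,j,\psi)$ the series over $i,n,i',n'$ converges absolutely. -/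

import Mathlib

open MeasureTheory Filter Topology

noncomputable section

/-! ### Frames in a Hilbert space -/

section Frames

variable {H : Type*} [NormedAddCommGroup H] [InnerProductSpace ℂ H] {ι : Type*}

/-- `A > 0` satisfies the first frame inequality for the family `x`. -/
def IsLowerFrameBound (x : ι → H) (A : ℝ) : Prop :=
  0 < A ∧ ∀ f : H, A * ‖f‖ ^ 2 ≤ ∑' i, ‖inner ℂ (x i) f‖ ^ 2

/-- `B > 0` satisfies the second frame inequality for the family `x` (a Bessel bound);
convergence of the series is part of the requirement. -/
def IsUpperFrameBound (x : ι → H) (B : ℝ) : Prop :=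
  0 < B ∧ ∀ f : H, Summable (fun i => ‖inner ℂ (x i) f‖ ^ 2) ∧
    ∑' i, ‖inner ℂ (x i) f‖ ^ 2 ≤ B * ‖f‖ ^ 2

/-- The family `x` is a frame. -/
def IsFrame (x : ι → H) : Prop :=
  ∃ A B : ℝ, IsLowerFrameBound x A ∧ IsUpperFrameBound x B

/-- The family `x` is a tight frame with frame bound `B`: it is a frame, and the sharpest
constants in the two frame inequalities are both equal to `B`. -/
def IsTightFrame (x : ι → H) (B : ℝ) : Prop :=
  IsFrame x ∧ IsGreatest {A | IsLowerFrameBound x A} B ∧ IsLeast {C | IsUpperFrameBound x C} B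

end Frames

/-! ### Translation and dilation on `L²(ℝ)` -/

/-- The Hilbert space `L²(ℝ)` of complex-valued functions. -/
abbrev L2R : Type := Lp ℂ 2 (volume : Measure ℝ)

theorem measurePreserving_sub_const (a : ℝ) :
    MeasurePreserving (fun x : ℝ => x - a) volume volume :=
  measurePreserving_sub_right volume a

/-- Translation by `a`: `f ↦ f (· - a)`. -/
def translateBy (a : ℝ) : L2R →ₗᵢ[ℂ] L2R :=
  Lp.compMeasurePreservingₗᵢ ℂ (fun x : ℝ => x - a) (measurePreserving_sub_const a)

theorem translateBy_ae (a : ℝ) (f : L2R) :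
    (translateBy a f : ℝ → ℂ) =ᵐ[volume] fun x => f (x - a) :=
  Lp.coeFn_compMeasurePreserving f (measurePreserving_sub_const a)

theorem translateBy_translateBy (a b : ℝ) (h : a + b = 0) (f : L2R) :
    translateBy a (translateBy b f) = f := by
  apply Lp.ext
  have h1 := translateBy_ae a (translateBy b f)
  have h2 := (measurePreserving_sub_const a).quasiMeasurePreserving.ae (translateBy_ae b f)
  filter_upwards [h1, h2] with x hx1 hx2
  rw [hx1, hx2]
  congr 1
  linarith

/-- The translation operator `T`, `[T f](x) = f (x - 1)`, as a unitary operator. -/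
def opT : L2R ≃ₗᵢ[ℂ] L2R where
  toLinearEquiv := LinearEquiv.ofLinearMap (translateBy 1).toLinearMap (translateBy (-1)).toLinearMap
    (by ext1 f; exact translateBy_translateBy 1 (-1) (by norm_num) f)
    (by ext1 f; exact translateBy_translateBy (-1) 1 (by norm_num) f)
  norm_map' := (translateBy 1).norm_map

theorem opT_ae (f : L2R) : (opT f : ℝ → ℂ) =ᵐ[volume] fun x => f (x - 1) :=
  translateBy_ae 1 f

theorem quasiMeasurePreserving_mul_const {c : ℝ} (hc : 0 < c) :
    Measure.QuasiMeasurePreserving (fun x : ℝ => c * x) volume volume := by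
  refine ⟨measurable_const_mul c, ?_⟩
  rw [Real.map_volume_mul_left hc.ne']
  exact Measure.smul_absolutelyContinuous

theorem eLpNorm_dilate {c : ℝ} (hc : 0 < c) (f : L2R) :
    eLpNorm (fun x => (Real.sqrt c : ℂ) * f (c * x)) 2 volume = eLpNorm f 2 volume := by
  have h1 : eLpNorm (fun x => f (c * x)) 2 volume
      = ENNReal.ofReal (c⁻¹ ^ (1 / 2 : ℝ)) * eLpNorm f 2 volume := by
    have hm : eLpNorm (f : ℝ → ℂ) 2 (Measure.map (fun x : ℝ => c * x) volume)
        = eLpNorm ((f : ℝ → ℂ) ∘ fun x => c * x) 2 volume :=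
      eLpNorm_map_measure
        ((Lp.aestronglyMeasurable f).mono_ac (quasiMeasurePreserving_mul_const hc).2)
        (measurable_const_mul c).aemeasurable
    have hm' : eLpNorm (fun x => f (c * x)) 2 volume
        = eLpNorm (f : ℝ → ℂ) 2 (Measure.map (fun x : ℝ => c * x) volume) := hm.symm
    rw [hm', Real.map_volume_mul_left hc.ne',
      eLpNorm_smul_measure_of_ne_top (by norm_num), abs_of_pos (inv_pos.2 hc), smul_eq_mul,
      ENNReal.ofReal_rpow_of_pos (inv_pos.2 hc)]
    norm_num
  have h2 : (fun x => (Real.sqrt c : ℂ) * f (c * x))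
      = (Real.sqrt c : ℂ) • fun x => f (c * x) := rfl
  rw [h2, eLpNorm_const_smul, h1, ← mul_assoc]
  have h3 : ‖(Real.sqrt c : ℂ)‖ₑ = ENNReal.ofReal (Real.sqrt c) := by
    rw [← ofReal_norm]
    simp [abs_of_nonneg (Real.sqrt_nonneg c)]
  rw [h3, ← ENNReal.ofReal_mul (Real.sqrt_nonneg c), ← Real.sqrt_eq_rpow, Real.sqrt_inv,
    mul_inv_cancel₀ (Real.sqrt_pos.2 hc).ne']
  simp

theorem memLp_dilate {c : ℝ} (hc : 0 < c) (f : L2R) :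
    MemLp (fun x => (Real.sqrt c : ℂ) * f (c * x)) 2 (volume : Measure ℝ) := by
  refine ⟨?_, ?_⟩
  · exact ((Lp.aestronglyMeasurable f).comp_quasiMeasurePreserving
      (quasiMeasurePreserving_mul_const hc)).const_mul _
  · rw [eLpNorm_dilate hc]
    exact Lp.eLpNorm_lt_top f

/-- Dilation by `c > 0`: `f ↦ c ^ (1/2) f (c ·)`. -/
def dilateBy (c : ℝ) (hc : 0 < c) : L2R →ₗᵢ[ℂ] L2R where
  toFun f := (memLp_dilate hc f).toLp _
  map_add' f g := by
    rw [← MemLp.toLp_add, MemLp.toLp_eq_toLp_iff]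
    filter_upwards [(quasiMeasurePreserving_mul_const hc).ae (Lp.coeFn_add f g)] with x hx
    simp only [Pi.add_apply] at hx ⊢
    rw [hx, mul_add]
  map_smul' a f := by
    rw [RingHom.id_apply, ← MemLp.toLp_const_smul, MemLp.toLp_eq_toLp_iff]
    filter_upwards [(quasiMeasurePreserving_mul_const hc).ae (Lp.coeFn_smul a f)] with x hx
    simp only [Pi.smul_apply, smul_eq_mul] at hx ⊢
    rw [hx]
    ring
  norm_map' f := by
    change ‖(memLp_dilate hc f).toLp _‖ = ‖f‖
    rw [Lp.norm_toLp, eLpNorm_dilate hc, Lp.norm_def]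

theorem dilateBy_ae {c : ℝ} (hc : 0 < c) (f : L2R) :
    (dilateBy c hc f : ℝ → ℂ) =ᵐ[volume] fun x => (Real.sqrt c : ℂ) * f (c * x) :=
  (memLp_dilate hc f).coeFn_toLp

theorem dilateBy_dilateBy {a b : ℝ} (ha : 0 < a) (hb : 0 < b) (h : a * b = 1) (f : L2R) :
    dilateBy a ha (dilateBy b hb f) = f := by
  apply Lp.ext
  filter_upwards [dilateBy_ae ha (dilateBy b hb f),
    (quasiMeasurePreserving_mul_const ha).ae (dilateBy_ae hb f)] with x hx1 hx2
  rw [hx1, hx2, ← mul_assoc, ← mul_assoc, mul_comm b a, h, one_mul, ← Complex.ofReal_mul,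
    ← Real.sqrt_mul ha.le, h]
  simp

/-- The dyadic dilation operator `D`, `[D f](x) = 2 ^ (1/2) f (2 x)`, as a unitary operator. -/
def opD : L2R ≃ₗᵢ[ℂ] L2R where
  toLinearEquiv := LinearEquiv.ofLinearMap (dilateBy 2 two_pos).toLinearMap
    (dilateBy 2⁻¹ (inv_pos.2 two_pos)).toLinearMap
    (by ext1 f; exact dilateBy_dilateBy two_pos (inv_pos.2 two_pos) (by norm_num) f)
    (by ext1 f; exact dilateBy_dilateBy (inv_pos.2 two_pos) two_pos (by norm_num) f)
  norm_map' := (dilateBy 2 two_pos).norm_map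

theorem opD_ae (f : L2R) : (opD f : ℝ → ℂ) =ᵐ[volume] fun x => (Real.sqrt 2 : ℂ) * f (2 * x) :=
  dilateBy_ae two_pos f

/-- The wavelet system `ψ_{k,j} = D ^ k T ^ j ψ` generated by the family `ψ`, indexed by the
triplets `(k, j, ψ)`. -/
def waveletSystem {P : Type*} (ψ : P → L2R) (t : ℤ × ℤ × P) : L2R :=
  (opD ^ t.1) ((opT ^ t.2.1) (ψ t.2.2))

/-! ### The bases and the coefficients -/

/-- `L²(S)`, as the subspace of `L²(ℝ)` of the functions that vanish a.e. outside `S`. -/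
def L2On (S : Set ℝ) : Submodule ℂ L2R where
  carrier := {f | ∀ᵐ x : ℝ, x ∉ S → f x = 0}
  zero_mem' := by
    filter_upwards [Lp.coeFn_zero ℂ 2 (volume : Measure ℝ)] with x hx _
    exact hx
  add_mem' {f g} hf hg := by
    filter_upwards [hf, hg, Lp.coeFn_add f g] with x hf hg h hx
    rw [h, Pi.add_apply, hf hx, hg hx, add_zero]
  smul_mem' a f hf := by
    filter_upwards [hf, Lp.coeFn_smul a f] with x hf h hx
    rw [h, Pi.smul_apply, hf hx, smul_zero]

/-- The interval `[±1, ±2)`, where the sign `±` is a unit of `ℤ`: `[1, 2)` for the sign `1` and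
`(-2, -1]` for the sign `-1`. -/
def signedInterval (s : ℤˣ) : Set ℝ := {x | ((s : ℤ) : ℝ) * x ∈ Set.Ico (1 : ℝ) 2}

section Coefficients

variable {I J P : Type*}

/-- `L_i^{(n)} = T ^ n L_i^{(0)}`. -/
def basisL (L : HilbertBasis I ℂ (L2On (Set.Ico 0 1))) (i : I) (n : ℤ) : L2R :=
  (opT ^ n) (L i : L2R)

/-- `K_{s,l}^{(m)} = D ^ m K_{s,l}^{(0)}`. -/
def basisK (K : ∀ s : ℤˣ, HilbertBasis J ℂ (L2On (signedInterval s)))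
    (s : ℤˣ) (l : J) (m : ℤ) : L2R :=
  (opD ^ m) (K s l : L2R)

/-- `α_{i,n}^{s,l,m} = ⟨L_i^{(n)}, K_{s,l}^{(m)}⟩`, where `⟨·,·⟩` is linear in its first
argument (Mathlib's `inner` is linear in the second one). -/
def alphaCoeff (L : HilbertBasis I ℂ (L2On (Set.Ico 0 1)))
    (K : ∀ s : ℤˣ, HilbertBasis J ℂ (L2On (signedInterval s)))
    (i : I) (n : ℤ) (s : ℤˣ) (l : J) (m : ℤ) : ℂ :=
  inner ℂ (basisK K s l m) (basisL L i n)

/-- `f̂_i^{(n)} = ⟨f, L_i^{(n)}⟩`, where `⟨·,·⟩` is linear in its first argument. -/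
def hatCoeff (L : HilbertBasis I ℂ (L2On (Set.Ico 0 1))) (f : L2R) (i : I) (n : ℤ) : ℂ :=
  inner ℂ (basisL L i n) f

/-- The product of coefficients
`conj α_{i,n+j}^{s,l,k} * α_{i',n'+j}^{s',l',k+σ}`, where `q = ((i, n), (i', n'))`. -/
def alphaTerm (L : HilbertBasis I ℂ (L2On (Set.Ico 0 1)))
    (K : ∀ s : ℤˣ, HilbertBasis J ℂ (L2On (signedInterval s)))
    (s s' : ℤˣ) (l l' : J) (σ : ℤ) (k j : ℤ) (q : (I × ℤ) × (I × ℤ)) : ℂ :=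
  starRingEnd ℂ (alphaCoeff L K q.1.1 (q.1.2 + j) s l k) *
    alphaCoeff L K q.2.1 (q.2.2 + j) s' l' (k + σ)

/-- The product of coefficients `conj f̂_i^{(n)} * f̂_{i'}^{(n')}`, where
`q = ((i, n), (i', n'))`. -/
def hatTerm (L : HilbertBasis I ℂ (L2On (Set.Ico 0 1))) (f : L2R)
    (q : (I × ℤ) × (I × ℤ)) : ℂ :=
  starRingEnd ℂ (hatCoeff L f q.1.1 q.1.2) * hatCoeff L f q.2.1 q.2.2

end Coefficients

end

/-! A system is tight with bound `B` iff its frame operator is `B • 1`, and this can be tested on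
the matrix in one Hilbert basis (`isTightFrame_iff_hasSum_hilbertBasis`). The basis used is
`basisK`: dyadic dilates of `[1, 2)` and `(-2, -1]` tile the line up to a null set. As `D` is
unitary and shifts the scale index, matrix entries depend on the scales only through `σ = m' - m`
(`hasSum_frame_matrix_iff`). Expanding both factors of an entry in the basis `basisL`, which `T`
merely shifts, turns each triplet's contribution into an absolutely convergent double series in `α`
and `ψ̂` (`hasSum_alphaTerm_mul_hatTerm`). For limits over all finite sets of triplets this is
already the claim.

Limits over products `F₁ × F₂` are weaker a priori. The diagonal entries (`s = s'`, `l = l'`, `σ =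
0`) have nonnegative terms, so for them a product limit forces summability; they dominate the other
entries (`hasSum_matrixTerm_iff_tendsto`). -/

noncomputable section

/-! ### Tight frames and the matrix of the frame operator. -/

section FrameTheory

variable {H : Type*} [NormedAddCommGroup H] [InnerProductSpace ℂ H] {ι κ : Type*}

theorem isTightFrame_iff_hasSum [Nontrivial H] {x : ι → H} {B : ℝ} (hB : 0 < B) :
    IsTightFrame x B ↔ ∀ f : H, HasSum (fun i => ‖inner ℂ (x i) f‖ ^ 2) (B * ‖f‖ ^ 2) := by
  constructor
  · rintro ⟨-, h1, h2⟩ f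
    have hl := h1.1.2 f
    have hu := h2.1.2 f
    have := hu.1.hasSum
    rwa [le_antisymm hu.2 hl] at this
  · intro h
    obtain ⟨f, hf⟩ := exists_ne (0 : H)
    have hf' : 0 < ‖f‖ ^ 2 := by positivity
    have hl : IsLowerFrameBound x B := ⟨hB, fun g => (h g).tsum_eq.ge⟩
    have hu : IsUpperFrameBound x B := ⟨hB, fun g => ⟨(h g).summable, (h g).tsum_eq.le⟩⟩
    refine ⟨⟨B, B, hl, hu⟩, ⟨hl, fun A hA => ?_⟩, ⟨hu, fun C hC => ?_⟩⟩
    · have := hA.2 f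
      rw [(h f).tsum_eq] at this
      exact le_of_mul_le_mul_right this hf'
    · have := (hC.2 f).2
      rw [(h f).tsum_eq] at this
      exact le_of_mul_le_mul_right this hf'

/-- Polarization, applied both to the vectors `f`, `g` and, term by term, to their coefficients. -/
theorem hasSum_inner_mul_inner {x : ι → H} {B : ℝ}
    (h : ∀ f : H, HasSum (fun i => ‖inner ℂ (x i) f‖ ^ 2) (B * ‖f‖ ^ 2)) (f g : H) :
    HasSum (fun i => inner ℂ f (x i) * inner ℂ (x i) g) ((B : ℂ) * inner ℂ f g) := by
  have hc : ∀ f : H, HasSum (fun i => (‖inner ℂ (x i) f‖ : ℂ) ^ 2) ((B : ℂ) * (‖f‖ : ℂ) ^ 2) := by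
    intro f
    exact_mod_cast Complex.hasSum_ofReal.2 (h f)
  have key := ((((hc (f + g)).sub (hc (f - g))).add
    (((hc (f - Complex.I • g)).sub (hc (f + Complex.I • g))).mul_right Complex.I)).div_const 4)
  have hr : (B : ℂ) * inner ℂ f g = ((B : ℂ) * ‖f + g‖ ^ 2 - B * ‖f - g‖ ^ 2 +
      (B * ‖f - Complex.I • g‖ ^ 2 - B * ‖f + Complex.I • g‖ ^ 2) * Complex.I) / 4 := by
    rw [inner_eq_sum_norm_sq_div_four]
    simp only [RCLike.I_to_complex, Complex.coe_algebraMap]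
    ring
  rw [hr]
  refine (congrArg (HasSum · _) (funext fun i => ?_)).mpr key
  have h1 : inner ℂ f (x i) * inner ℂ (x i) g
      = inner ℂ (inner ℂ (x i) f : ℂ) (inner ℂ (x i) g : ℂ) := by
    rw [RCLike.inner_apply, inner_conj_symm, mul_comm]
  rw [h1, inner_eq_sum_norm_sq_div_four]
  simp only [inner_add_right, inner_sub_right, inner_smul_right, smul_eq_mul, RCLike.I_to_complex,
    Complex.coe_algebraMap]

/-- Sesquilinearity gives the identity on the span of the basis. It extends by density once the
analysis operator into `ℓ²` is known to be bounded, for then both sides are continuous in `f`. -/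
theorem hasSum_norm_sq_of_hilbertBasis (e : HilbertBasis κ ℂ H) {x : ι → H} {B : ℝ} (hB : 0 ≤ B)
    (h : ∀ a b, HasSum (fun i => inner ℂ (e a) (x i) * inner ℂ (x i) (e b))
      ((B : ℂ) * inner ℂ (e a) (e b))) (f : H) :
    HasSum (fun i => ‖inner ℂ (x i) f‖ ^ 2) (B * ‖f‖ ^ 2) := by
  set E := Submodule.span ℂ (Set.range e)
  have hspan : ∀ f ∈ E, ∀ g ∈ E, HasSum (fun i => inner ℂ f (x i) * inner ℂ (x i) g)
      ((B : ℂ) * inner ℂ f g) := by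
    intro f hf g hg
    induction hf using Submodule.span_induction with
    | zero => simp
    | add u v _ _ hu hv => simpa only [inner_add_left, add_mul, mul_add] using hu.add hv
    | smul c u _ hu =>
      simpa only [inner_smul_left, mul_assoc, mul_left_comm] using hu.mul_left (starRingEnd ℂ c)
    | mem u hu =>
      obtain ⟨a, rfl⟩ := hu
      induction hg using Submodule.span_induction with
      | zero => simp
      | add u v _ _ hu hv => simpa only [inner_add_right, mul_add] using hu.add hv
      | smul c u _ hu =>
        simpa only [inner_smul_right, mul_assoc, mul_left_comm] using hu.mul_left c
      | mem v hv =>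
        obtain ⟨b, rfl⟩ := hv
        exact h a b
  have hsq : ∀ f ∈ E, HasSum (fun i => ‖inner ℂ (x i) f‖ ^ 2) (B * ‖f‖ ^ 2) := by
    intro f hf
    refine Complex.hasSum_ofReal.1 ?_
    convert hspan f hf f hf using 1
    · funext i
      rw [← inner_conj_symm f (x i), mul_comm, RCLike.mul_conj]
      simp
    · rw [inner_self_eq_norm_sq_to_K]
      simp
  have hdense : Dense (E : Set H) :=
    Submodule.dense_iff_topologicalClosure_eq_top.2 e.dense_span
  -- For a fixed finite `F` the Bessel inequality is a closed condition, so it passes from the dense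
  -- span to all of `H`.
  have hfin : ∀ (F : Finset ι) (f : H), ∑ i ∈ F, ‖inner ℂ (x i) f‖ ^ 2 ≤ B * ‖f‖ ^ 2 := by
    intro F
    have hcl : IsClosed {f : H | ∑ i ∈ F, ‖inner ℂ (x i) f‖ ^ 2 ≤ B * ‖f‖ ^ 2} :=
      isClosed_le (by fun_prop) (by fun_prop)
    intro f
    exact hcl.closure_subset_iff.2
      (fun g hg => sum_le_hasSum F (fun _ _ => by positivity) (hsq g hg)) (hdense f)
  have hmem : ∀ f : H, Memℓp (fun i => (inner ℂ (x i) f : ℂ)) 2 := by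
    intro f
    refine memℓp_gen' (C := B * ‖f‖ ^ 2) fun F => ?_
    simpa using hfin F f
  let V₀ : H →ₗ[ℂ] lp (fun _ : ι => ℂ) 2 :=
    { toFun := fun f => ⟨fun i => inner ℂ (x i) f, hmem f⟩
      map_add' := fun f g => by ext i; exact inner_add_right _ _ _
      map_smul' := fun c f => by ext i; exact inner_smul_right _ _ _ }
  have hV : ∀ f i, V₀ f i = inner ℂ (x i) f := fun f i => rfl
  have hnorm : ∀ f, HasSum (fun i => ‖inner ℂ (x i) f‖ ^ 2) (‖V₀ f‖ ^ 2) := by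
    intro f
    simpa [hV] using lp.hasSum_norm (p := 2) (by norm_num) (V₀ f)
  let V : H →L[ℂ] lp (fun _ : ι => ℂ) 2 := V₀.mkContinuous (Real.sqrt B) fun f => by
    refine le_of_sq_le_sq ?_ (by positivity)
    rw [mul_pow, Real.sq_sqrt hB]
    exact hasSum_le_of_sum_le (hnorm f) fun F => hfin F f
  have heq : (fun f => ‖V f‖ ^ 2) = fun f => B * ‖f‖ ^ 2 := by
    refine Continuous.ext_on hdense (by fun_prop) (by fun_prop) fun f hf => ?_
    exact (hnorm f).unique (hsq f hf)
  have := hnorm f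
  rwa [show ‖V₀ f‖ ^ 2 = B * ‖f‖ ^ 2 from congrFun heq f] at this

/-- A family is tight with bound `B` iff its frame operator has the matrix of `B • 1` in a given
Hilbert basis. -/
theorem isTightFrame_iff_hasSum_hilbertBasis [Nontrivial H] (e : HilbertBasis κ ℂ H) {x : ι → H}
    {B : ℝ} (hB : 0 < B) :
    IsTightFrame x B ↔ ∀ a b, HasSum (fun i => inner ℂ (e a) (x i) * inner ℂ (x i) (e b))
      ((B : ℂ) * inner ℂ (e a) (e b)) := by
  rw [isTightFrame_iff_hasSum hB]
  exact ⟨fun h a b => hasSum_inner_mul_inner h _ _, hasSum_norm_sq_of_hilbertBasis e hB.le⟩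

end FrameTheory

/-! ### Unconditional sums and limits over finite rectangles. -/

section ProductLimits

variable {α β : Type*}

theorem tendsto_finset_product_atTop :
    Tendsto (fun F : Finset α × Finset β => F.1 ×ˢ F.2) atTop atTop := by
  classical
  refine tendsto_atTop.2 fun F => ?_
  filter_upwards [eventually_ge_atTop (F.image Prod.fst, F.image Prod.snd)] with G hG
  intro t ht
  exact Finset.mem_product.2
    ⟨hG.1 (Finset.mem_image_of_mem _ ht), hG.2 (Finset.mem_image_of_mem _ ht)⟩

/-- Rectangular sums of nonnegative terms increase to their limit, and each finite set lies in the
rectangle of its projections; so all finite sums are bounded by `a`. -/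
theorem hasSum_of_tendsto_sum_product {f : α × β → ℝ} (hf : ∀ t, 0 ≤ f t) {a : ℝ}
    (h : Tendsto (fun F : Finset α × Finset β => ∑ t ∈ F.1 ×ˢ F.2, f t) atTop (𝓝 a)) :
    HasSum f a := by
  classical
  have hmono : Monotone fun F : Finset α × Finset β => ∑ t ∈ F.1 ×ˢ F.2, f t := fun F G hFG =>
    Finset.sum_le_sum_of_subset_of_nonneg (Finset.product_subset_product hFG.1 hFG.2)
      fun t _ _ => hf t
  have hs : Summable f := by
    refine summable_of_sum_le (c := a) hf fun F => ?_
    refine le_trans ?_ (hmono.ge_of_tendsto h (F.image Prod.fst, F.image Prod.snd))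
    exact Finset.sum_le_sum_of_subset_of_nonneg Finset.subset_product fun t _ _ => hf t
  have := tendsto_nhds_unique (hs.hasSum.comp tendsto_finset_product_atTop) h
  exact this ▸ hs.hasSum

end ProductLimits

/-! ### Bases of `L²(ℝ)` assembled from bases on tiles. -/

section SupportedBases

theorem nontrivial_L2R : Nontrivial L2R := by
  refine ⟨⟨indicatorConstLp 2 (measurableSet_Icc (a := (0 : ℝ)) (b := 1)) (by simp) (1 : ℂ), 0, ?_⟩⟩
  intro h
  have := congrArg norm h
  rw [norm_indicatorConstLp (by norm_num) (by norm_num)] at this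
  simp at this

theorem inner_eq_zero_of_disjoint {S S' : Set ℝ} (hd : Disjoint S S') {f g : L2R}
    (hf : f ∈ L2On S) (hg : g ∈ L2On S') : inner ℂ f g = 0 := by
  rw [L2.inner_def]
  refine integral_eq_zero_of_ae ?_
  filter_upwards [hf, hg] with x hx hx'
  by_cases h : x ∈ S
  · simp [hx' (Set.disjoint_left.1 hd h)]
  · simp [hx h]

/-- The test function is the truncation of `f` to `S`: its inner product with `f` is its own squared
norm. -/
theorem ae_eq_zero_of_inner_eq_zero {S : Set ℝ} (hS : MeasurableSet S) {f : L2R}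
    (h : ∀ g ∈ L2On S, inner ℂ g f = 0) : ∀ᵐ x : ℝ, x ∈ S → f x = 0 := by
  have hm : MemLp (S.indicator f) 2 (volume : Measure ℝ) := (Lp.memLp f).indicator hS
  have hae := hm.coeFn_toLp
  set g : L2R := hm.toLp _
  have hg : g ∈ L2On S := by
    filter_upwards [hae] with x hx hxS
    rw [hx, Set.indicator_of_notMem hxS]
  have hgg : inner ℂ g g = (0 : ℂ) := by
    rw [← h g hg, L2.inner_def, L2.inner_def]
    refine integral_congr_ae ?_
    filter_upwards [hae] with x hx
    by_cases hxS : x ∈ S <;> simp [hx, hxS]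
  rw [inner_self_eq_zero] at hgg
  have h0 := Lp.coeFn_zero ℂ 2 (volume : Measure ℝ)
  rw [← hgg] at h0
  filter_upwards [h0, hae] with x hx0 hx hxS
  rw [hx, Set.indicator_of_mem hxS] at hx0
  simpa using hx0

theorem inner_eq_zero_of_hilbertBasis {H ι : Type*} [NormedAddCommGroup H] [InnerProductSpace ℂ H]
    {E : Submodule ℂ H} (b : HilbertBasis ι ℂ E) {f : H} (h : ∀ i, inner ℂ (b i : H) f = 0)
    (g : H) (hg : g ∈ E) : inner ℂ g f = 0 := by
  have h1 := (b.hasSum_repr ⟨g, hg⟩).mapL E.subtypeL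
  have h2 := h1.mapL (innerSL ℂ f)
  have h3 : inner ℂ f g = (0 : ℂ) := by
    refine h2.unique ?_
    convert hasSum_zero using 2 with i
    simp [inner_eq_zero_symm.1 (h i)]
  exact inner_eq_zero_symm.1 h3

/-- Bases of the spaces `L²(S a)`, moved by unitary weighted composition operators so that the
supports tile the line, form a basis of `L²(ℝ)`. -/
theorem exists_hilbertBasis_of_tiling {A ι : Type*} [Countable A] (S : A → Set ℝ)
    (hS : ∀ a, MeasurableSet (S a)) (b : ∀ a, HilbertBasis ι ℂ (L2On (S a)))
    (U : A → (L2R ≃ₗᵢ[ℂ] L2R)) (g : A → ℝ → ℝ) (c : A → ℂ)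
    (hg : ∀ a, Measure.QuasiMeasurePreserving (g a) volume volume)
    (hU : ∀ a f, (U a f : ℝ → ℂ) =ᵐ[volume] fun x => c a * f (g a x))
    (hd : ∀ a a', a ≠ a' → Disjoint (g a ⁻¹' S a) (g a' ⁻¹' S a'))
    (hcover : ∀ᵐ x : ℝ, ∃ a, g a x ∈ S a) :
    ∃ e : HilbertBasis (A × ι) ℂ L2R, ∀ t, e t = U t.1 (b t.1 t.2 : L2R) := by
  have hsupp : ∀ a, ∀ f ∈ L2On (S a), U a f ∈ L2On (g a ⁻¹' S a) := by
    intro a f hf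
    filter_upwards [hU a f, (hg a).ae hf] with x hx hx' hxS
    rw [hx, hx' hxS, mul_zero]
  have hon : Orthonormal ℂ fun t : A × ι => U t.1 (b t.1 t.2 : L2R) := by
    refine ⟨fun t => ?_, ?_⟩
    · rw [LinearIsometryEquiv.norm_map]
      exact (b t.1).orthonormal.1 t.2
    · rintro ⟨a, i⟩ ⟨a', i'⟩ hne
      by_cases ha : a = a'
      · subst ha
        have hi : i ≠ i' := fun h => hne (by rw [h])
        change inner ℂ (U a _) (U a _) = (0 : ℂ)
        rw [LinearIsometryEquiv.inner_map_map]
        exact (b a).orthonormal.2 hi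
      · exact inner_eq_zero_of_disjoint (hd a a' ha) (hsupp a _ (b a i).2) (hsupp a' _ (b a' i').2)
  -- A vector orthogonal to the system, pulled back by `U a`, is orthogonal to `L²(S a)`; hence it
  -- vanishes a.e. on each tile, and countably many tiles cover almost everything.
  have hbot : (Submodule.span ℂ (Set.range fun t : A × ι => U t.1 (b t.1 t.2 : L2R)))ᗮ = ⊥ := by
    rw [Submodule.eq_bot_iff]
    intro f hf
    have hf' : ∀ a i, inner ℂ (b a i : L2R) ((U a).symm f) = 0 := by
      intro a i
      rw [← (U a).inner_map_map, LinearIsometryEquiv.apply_symm_apply]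
      exact hf _ (Submodule.subset_span ⟨(a, i), rfl⟩)
    have hzero : ∀ a, ∀ᵐ x : ℝ, g a x ∈ S a → f x = 0 := by
      intro a
      have h1 := ae_eq_zero_of_inner_eq_zero (hS a) (inner_eq_zero_of_hilbertBasis (b a) (hf' a))
      have h2 := hU a ((U a).symm f)
      rw [LinearIsometryEquiv.apply_symm_apply] at h2
      filter_upwards [h2, (hg a).ae h1] with x hx hx' hxS
      rw [hx, hx' hxS, mul_zero]
    apply Lp.ext
    filter_upwards [hcover, ae_all_iff.2 hzero, Lp.coeFn_zero ℂ 2 (volume : Measure ℝ)]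
      with x ⟨a, ha⟩ hx h0
    rw [h0, hx a ha]
    rfl
  refine ⟨HilbertBasis.mkOfOrthogonalEqBot hon hbot, fun t => ?_⟩
  rw [HilbertBasis.coe_mkOfOrthogonalEqBot]

theorem opT_zpow_ae (n : ℤ) (f : L2R) :
    ((opT ^ n) f : ℝ → ℂ) =ᵐ[volume] fun x => f (x - n) := by
  induction n generalizing f with
  | zero => simp
  | succ n ih =>
    rw [zpow_add_one]
    filter_upwards [ih (opT f),
      (measurePreserving_sub_const (n : ℝ)).quasiMeasurePreserving.ae (opT_ae f)] with x h1 h2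
    change (opT ^ (n : ℤ)) (opT f) x = _
    rw [h1]
    push_cast
    rw [h2, sub_sub]
  | pred n ih =>
    rw [zpow_sub_one]
    filter_upwards [ih (opT⁻¹ f), (measurePreserving_sub_const (-n : ℝ)).quasiMeasurePreserving.ae
      (translateBy_ae (-1) f)] with x h1 h2
    change (opT ^ (-n : ℤ)) (opT⁻¹ f) x = _
    rw [h1]
    push_cast
    change translateBy (-1) f _ = _
    rw [h2, sub_sub]
    rfl

/-- The constant is left unspecified because the tiling argument only needs to know where functions
vanish. -/
theorem opD_zpow_ae (m : ℤ) :
    ∃ c : ℂ, ∀ f : L2R, ((opD ^ m) f : ℝ → ℂ) =ᵐ[volume] fun x => c * f ((2 : ℝ) ^ m * x) := by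
  induction m with
  | zero => exact ⟨1, fun f => by simp⟩
  | succ n ih =>
    obtain ⟨c, hc⟩ := ih
    refine ⟨c * (Real.sqrt 2 : ℂ), fun f => ?_⟩
    rw [zpow_add_one]
    filter_upwards [hc (opD f), (quasiMeasurePreserving_mul_const
      (zpow_pos (two_pos (α := ℝ)) n)).ae (opD_ae f)] with x h1 h2
    change (opD ^ (n : ℤ)) (opD f) x = _
    rw [h1, h2, zpow_add_one₀ two_ne_zero, ← mul_assoc, ← mul_assoc, mul_comm 2 ((2 : ℝ) ^ (n : ℤ))]
  | pred n ih =>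
    obtain ⟨c, hc⟩ := ih
    refine ⟨c * (Real.sqrt 2⁻¹ : ℝ), fun f => ?_⟩
    rw [zpow_sub_one]
    filter_upwards [hc (opD⁻¹ f), (quasiMeasurePreserving_mul_const
      (zpow_pos (two_pos (α := ℝ)) (-n))).ae (dilateBy_ae (inv_pos.2 two_pos) f)] with x h1 h2
    change (opD ^ (-n : ℤ)) (opD⁻¹ f) x = _
    rw [h1]
    change c * dilateBy 2⁻¹ (inv_pos.2 two_pos) f _ = _
    rw [h2, zpow_sub_one₀ two_ne_zero, ← mul_assoc, ← mul_assoc, mul_comm 2⁻¹ ((2 : ℝ) ^ (-n : ℤ))]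

end SupportedBases

/-! ### The translation basis and the dilation basis. -/

section WaveletBases

variable {I J P : Type*}

theorem exists_hilbertBasis_basisL (L : HilbertBasis I ℂ (L2On (Set.Ico 0 1))) :
    ∃ e : HilbertBasis (ℤ × I) ℂ L2R, ∀ t, e t = basisL L t.2 t.1 := by
  refine exists_hilbertBasis_of_tiling (fun _ : ℤ => Set.Ico (0 : ℝ) 1)
    (fun _ => measurableSet_Ico) (fun _ => L) (fun n => opT ^ n) (fun n x => x - n) (fun _ => 1)
    (fun n => (measurePreserving_sub_const (n : ℝ)).quasiMeasurePreserving)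
    (fun n f => by simpa using opT_zpow_ae n f) ?_ ?_
  · intro n n' hne
    refine Set.disjoint_left.2 fun x hx hx' => hne ?_
    have key : ∀ m : ℤ, x - m ∈ Set.Ico (0 : ℝ) 1 → ⌊x⌋ = m := fun m hm =>
      Int.floor_eq_iff.2 ⟨by linarith [hm.1], by linarith [hm.2]⟩
    rw [← key n hx, key n' hx']
  · exact Eventually.of_forall fun x => ⟨⌊x⌋, Int.fract_nonneg x, Int.fract_lt_one x⟩

theorem measurableSet_signedInterval (s : ℤˣ) : MeasurableSet (signedInterval s) :=
  measurableSet_Ico.preimage (measurable_const_mul _)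

theorem exists_hilbertBasis_basisK (K : ∀ s : ℤˣ, HilbertBasis J ℂ (L2On (signedInterval s))) :
    ∃ e : HilbertBasis ((ℤˣ × ℤ) × J) ℂ L2R, ∀ t, e t = basisK K t.1.1 t.2 t.1.2 := by
  choose c hc using opD_zpow_ae
  refine exists_hilbertBasis_of_tiling (fun a : ℤˣ × ℤ => signedInterval a.1)
    (fun a => measurableSet_signedInterval a.1) (fun a => K a.1) (fun a => opD ^ a.2)
    (fun a x => (2 : ℝ) ^ a.2 * x) (fun a => c a.2)
    (fun a => quasiMeasurePreserving_mul_const (zpow_pos two_pos a.2)) (fun a => hc a.2) ?_ ?_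
  · rintro ⟨s, m⟩ ⟨s', m'⟩ hne
    refine Set.disjoint_left.2 fun x hx hx' => hne ?_
    simp only [signedInterval, Set.mem_preimage, Set.mem_ofPred_eq] at hx hx'
    -- A point determines its tile: `s` is the sign of `x`, and `2 ^ m * |x| ∈ [1, 2)` forces `-m =
    -- ⌊log₂ |x|⌋`.
    have hs : ∀ (s : ℤˣ) (m : ℤ), ((s : ℤ) : ℝ) * ((2 : ℝ) ^ m * x) ∈ Set.Ico (1 : ℝ) 2 →
        0 < ((s : ℤ) : ℝ) * x ∧ -m = Int.log 2 (((s : ℤ) : ℝ) * x) := by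
      intro s m h
      have h2 : (0 : ℝ) < 2 ^ m := zpow_pos two_pos m
      rw [mul_left_comm] at h
      have hpos : 0 < ((s : ℤ) : ℝ) * x := pos_of_mul_pos_right (one_pos.trans_le h.1) h2.le
      refine ⟨hpos, le_antisymm ?_ ?_⟩
      · rw [← Int.zpow_le_iff_le_log one_lt_two hpos]
        push_cast
        rw [zpow_neg]
        exact (inv_le_iff_one_le_mul₀' h2).2 h.1
      · rw [← Int.lt_add_one_iff, ← Int.lt_zpow_iff_log_lt one_lt_two hpos]
        push_cast
        rw [zpow_add_one₀ two_ne_zero, zpow_neg, inv_mul_eq_div, lt_div_iff₀' h2]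
        exact h.2
    obtain ⟨p, q⟩ := hs s m hx
    obtain ⟨p', q'⟩ := hs s' m' hx'
    have hss : s = s' := by
      rcases Int.units_eq_one_or s with rfl | rfl <;>
        rcases Int.units_eq_one_or s' with rfl | rfl <;> simp at p p' ⊢ <;> linarith
    subst hss
    rw [← q'] at q
    rw [neg_inj.1 q]
  -- The origin is the only point in no tile.
  · have h0 : ∀ᵐ x : ℝ, x ≠ 0 := by simp [ae_iff]
    filter_upwards [h0] with x hx
    obtain ⟨s, hs⟩ : ∃ s : ℤˣ, 0 < ((s : ℤ) : ℝ) * x := by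
      rcases lt_or_gt_of_ne hx with h | h
      · exact ⟨-1, by simpa using h⟩
      · exact ⟨1, by simpa using h⟩
    refine ⟨(s, -Int.log 2 (((s : ℤ) : ℝ) * x)), ?_⟩
    have h2 : (0 : ℝ) < 2 ^ (Int.log 2 (((s : ℤ) : ℝ) * x)) := zpow_pos two_pos _
    have hl := Int.zpow_log_le_self (b := 2) one_lt_two hs
    have hu := Int.lt_zpow_succ_log_self (b := 2) one_lt_two (((s : ℤ) : ℝ) * x)
    push_cast at hl hu
    rw [zpow_add_one₀ two_ne_zero] at hu
    simp only [signedInterval, Set.mem_ofPred_eq, zpow_neg]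
    rw [mul_left_comm, inv_mul_eq_div]
    exact ⟨(one_le_div₀ h2).2 hl, (div_lt_iff₀' h2).2 hu⟩

end WaveletBases

/-- Summability in `ℂ` is absolute, so the product family is summable with no further hypothesis. -/
theorem hasSum_mul_complex {α β : Type*} {f : α → ℂ} {g : β → ℂ} {a b : ℂ} (hf : HasSum f a)
    (hg : HasSum g b) : HasSum (fun q : α × β => f q.1 * g q.2) (a * b) :=
  hf.mul hg (summable_mul_of_summable_norm hf.summable.norm hg.summable.norm)

theorem hasSum_starRingEnd {α : Type*} {f : α → ℂ} {a : ℂ} (hf : HasSum f a) :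
    HasSum (fun i => starRingEnd ℂ (f i)) (starRingEnd ℂ a) :=
  hf.star

theorem hasSum_conj_mul {α β : Type*} {f : α → ℂ} {g : β → ℂ} {a b : ℂ} (hf : HasSum f a)
    (hg : HasSum g b) :
    HasSum (fun q : α × β => starRingEnd ℂ (f q.1) * g q.2) (starRingEnd ℂ a * b) :=
  hasSum_mul_complex (f := fun i => starRingEnd ℂ (f i)) (hasSum_starRingEnd hf) hg

/-! ### Matrix entries of the wavelet system and their coefficient series. -/

section WaveletCoefficients

variable {I J P : Type*} (L : HilbertBasis I ℂ (L2On (Set.Ico 0 1)))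
  (K : ∀ s : ℤˣ, HilbertBasis J ℂ (L2On (signedInterval s)))

theorem opT_zpow_basisL (i : I) (n j : ℤ) :
    (opT ^ j) (basisL L i n) = basisL L i (n + j) := by
  rw [basisL, basisL, add_comm, zpow_add]
  rfl

/-- The expansion of `⟨T ^ j f, K_{s,l}^{(k)}⟩` in the basis `L_i^{(n)}`. -/
theorem hasSum_hatCoeff_mul_alphaCoeff (s : ℤˣ) (l : J) (k j : ℤ) (f : L2R) :
    HasSum (fun p : I × ℤ => hatCoeff L f p.1 p.2 * alphaCoeff L K p.1 (p.2 + j) s l k)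
      (inner ℂ (basisK K s l k) ((opT ^ j) f)) := by
  obtain ⟨e, he⟩ := exists_hilbertBasis_basisL L
  -- Parseval for `T ^ (-j) K` and `f`; moving `T ^ j` back onto the basis replaces `L_i^{(n)}` by
  -- `L_i^{(n+j)}`.
  have h := e.hasSum_inner_mul_inner ((opT ^ j).symm (basisK K s l k)) f
  rw [← (opT ^ j).inner_map_map, LinearIsometryEquiv.apply_symm_apply] at h
  rw [← (Equiv.prodComm ℤ I).hasSum_iff]
  refine h.congr_fun fun t => ?_
  rw [← (opT ^ j).inner_map_map ((opT ^ j).symm _), LinearIsometryEquiv.apply_symm_apply, he,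
    opT_zpow_basisL, mul_comm]
  rfl

theorem inner_basisK_waveletSystem (ψ : P → L2R) (s : ℤˣ) (l : J) (m : ℤ) (t : ℤ × ℤ × P) :
    inner ℂ (basisK K s l m) (waveletSystem ψ t)
      = inner ℂ (basisK K s l (m - t.1)) ((opT ^ t.2.1) (ψ t.2.2)) := by
  have h : basisK K s l m = (opD ^ t.1) (basisK K s l (m - t.1)) := by
    rw [basisK, basisK, ← add_sub_cancel t.1 m, zpow_add, add_sub_cancel]
    rfl
  rw [h, waveletSystem, LinearIsometryEquiv.inner_map_map]

/-- The contribution of the triplet `(k, j, ψ)` to the matrix of the frame operator. -/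
def matrixTerm (ψ : P → L2R) (s s' : ℤˣ) (l l' : J) (σ : ℤ) (t : ℤ × ℤ × P) : ℂ :=
  starRingEnd ℂ (inner ℂ (basisK K s l t.1) ((opT ^ t.2.1) (ψ t.2.2))) *
    inner ℂ (basisK K s' l' (t.1 + σ)) ((opT ^ t.2.1) (ψ t.2.2))

theorem hasSum_alphaTerm_mul_hatTerm (ψ : P → L2R) (s s' : ℤˣ) (l l' : J) (σ : ℤ)
    (t : ℤ × ℤ × P) :
    HasSum (fun q : (I × ℤ) × (I × ℤ) =>
        alphaTerm L K s s' l l' σ t.1 t.2.1 q * hatTerm L (ψ t.2.2) q)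
      (matrixTerm K ψ s s' l l' σ t) := by
  have h1 := hasSum_hatCoeff_mul_alphaCoeff L K s l t.1 t.2.1 (ψ t.2.2)
  have h2 := hasSum_hatCoeff_mul_alphaCoeff L K s' l' (t.1 + σ) t.2.1 (ψ t.2.2)
  rw [matrixTerm]
  refine (hasSum_conj_mul h1 h2).congr_fun fun q => ?_
  simp only [alphaTerm, hatTerm, map_mul]
  ring

/-- The matrix of the frame operator in the basis `K_{s,l}^{(m)}` is constant along dilations. -/
theorem hasSum_frame_matrix_iff (ψ : P → L2R) (s s' : ℤˣ) (l l' : J) (m m' : ℤ) (a : ℂ) :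
    HasSum (fun t => inner ℂ (basisK K s' l' m') (waveletSystem ψ t) *
        inner ℂ (waveletSystem ψ t) (basisK K s l m)) a ↔
      HasSum (matrixTerm K ψ s s' l l' (m' - m)) a := by
  -- Substituting `m - k` for `k` turns the scales `m - k` and `m' - k` into `k` and `k + (m' - m)`.
  rw [← ((Equiv.subLeft m).prodCongr (Equiv.refl (ℤ × P))).hasSum_iff]
  refine iff_of_eq (congrArg (HasSum · a) (funext fun t => ?_))
  rw [Function.comp_apply, ← inner_conj_symm (waveletSystem ψ _), inner_basisK_waveletSystem, inner_basisK_waveletSystem,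
    mul_comm]
  simp only [Equiv.prodCongr_apply, Prod.map_apply', Equiv.refl_apply,
    Equiv.subLeft_apply, matrixTerm]
  rw [sub_sub_cancel, show t.1 + (m' - m) = m' - (m - t.1) by ring]

theorem isTightFrame_waveletSystem_iff [DecidableEq J] (ψ : P → L2R) {B : ℝ} (hB : 0 < B) :
    IsTightFrame (waveletSystem ψ) B ↔ ∀ (s s' : ℤˣ) (l l' : J) (σ : ℤ),
      HasSum (matrixTerm K ψ s s' l l' σ) (if s = s' ∧ l = l' ∧ σ = 0 then (B : ℂ) else 0) := by
  classical
  have := nontrivial_L2R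
  obtain ⟨e, he⟩ := exists_hilbertBasis_basisK K
  have hδ : ∀ (s s' : ℤˣ) (l l' : J) (m m' : ℤ),
      (B : ℂ) * inner ℂ (e ((s', m'), l')) (e ((s, m), l))
        = if s = s' ∧ l = l' ∧ m' - m = 0 then (B : ℂ) else 0 := by
    intro s s' l l' m m'
    rw [orthonormal_iff_ite.1 e.orthonormal, mul_ite, mul_one, mul_zero]
    refine if_congr ?_ rfl rfl
    simp only [Prod.mk.injEq, sub_eq_zero]
    tauto
  rw [isTightFrame_iff_hasSum_hilbertBasis e hB]
  constructor
  · intro h s s' l l' σ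
    -- Every `σ` already occurs as a difference of scales with `m = 0`.
    have := h ((s', σ), l') ((s, 0), l)
    rw [hδ, he, he, hasSum_frame_matrix_iff] at this
    simpa only [sub_zero] using this
  · rintro h ⟨⟨s', m'⟩, l'⟩ ⟨⟨s, m⟩, l⟩
    rw [hδ, he, he, hasSum_frame_matrix_iff]
    exact h s s' l l' (m' - m)

theorem tsum_sum_alphaTerm_mul_hatTerm (ψ : P → L2R) (s s' : ℤˣ) (l l' : J) (σ : ℤ)
    (F : Finset (ℤ × ℤ × P)) :
    ∑' q : (I × ℤ) × (I × ℤ),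
        ∑ t ∈ F, alphaTerm L K s s' l l' σ t.1 t.2.1 q * hatTerm L (ψ t.2.2) q
      = ∑ t ∈ F, matrixTerm K ψ s s' l l' σ t :=
  (hasSum_sum fun t _ => hasSum_alphaTerm_mul_hatTerm L K ψ s s' l l' σ t).tsum_eq

theorem tsum_sum_alphaTerm_mul_sum_hatTerm (ψ : P → L2R) (s s' : ℤˣ) (l l' : J) (σ : ℤ)
    (F : Finset (ℤ × ℤ) × Finset P) :
    ∑' q : (I × ℤ) × (I × ℤ),
        (∑ t ∈ F.1, alphaTerm L K s s' l l' σ t.1 t.2 q) * (∑ p ∈ F.2, hatTerm L (ψ p) q)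
      = ∑ r ∈ F.1 ×ˢ F.2, matrixTerm K ψ s s' l l' σ (Equiv.prodAssoc ℤ ℤ P r) := by
  simp only [Finset.sum_mul_sum, ← Finset.sum_product']
  exact (hasSum_sum fun r _ =>
    hasSum_alphaTerm_mul_hatTerm L K ψ s s' l l' σ (Equiv.prodAssoc ℤ ℤ P r)).tsum_eq

theorem matrixTerm_self (ψ : P → L2R) (s : ℤˣ) (l : J) (t : ℤ × ℤ × P) :
    matrixTerm K ψ s s l l 0 t
      = ((‖(inner ℂ (basisK K s l t.1) ((opT ^ t.2.1) (ψ t.2.2)) : ℂ)‖ ^ 2 : ℝ) : ℂ) := by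
  rw [matrixTerm, add_zero, RCLike.conj_mul]
  simp

/-- For the converse, diagonal entries are summable by positivity; the others are then dominated by
diagonal ones. Once an entry is summable, its product limit must be its sum, since rectangles are
cofinal. -/
theorem hasSum_matrixTerm_iff_tendsto [DecidableEq J] (ψ : P → L2R) (B : ℝ) :
    (∀ (s s' : ℤˣ) (l l' : J) (σ : ℤ),
      HasSum (matrixTerm K ψ s s' l l' σ) (if s = s' ∧ l = l' ∧ σ = 0 then (B : ℂ) else 0)) ↔
    ∀ (s s' : ℤˣ) (l l' : J) (σ : ℤ),
      Tendsto (fun F : Finset (ℤ × ℤ) × Finset P =>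
          ∑ r ∈ F.1 ×ˢ F.2, matrixTerm K ψ s s' l l' σ (Equiv.prodAssoc ℤ ℤ P r))
        atTop (𝓝 (if s = s' ∧ l = l' ∧ σ = 0 then (B : ℂ) else 0)) := by
  classical
  constructor
  · intro h s s' l l' σ
    exact ((Equiv.prodAssoc ℤ ℤ P).hasSum_iff.2 (h s s' l l' σ)).comp tendsto_finset_product_atTop
  · intro h
    have hdiag : ∀ (s : ℤˣ) (l : J), Summable fun t : ℤ × ℤ × P =>
        ‖(inner ℂ (basisK K s l t.1) ((opT ^ t.2.1) (ψ t.2.2)) : ℂ)‖ ^ 2 := by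
      intro s l
      have := h s s l l 0
      simp only [matrixTerm_self, and_self, if_true, ← Complex.ofReal_sum] at this
      rw [← (Equiv.prodAssoc ℤ ℤ P).summable_iff]
      exact (hasSum_of_tendsto_sum_product (fun _ => sq_nonneg _)
        ((Complex.continuous_re.tendsto _).comp this)).summable
    intro s s' l l' σ
    -- Shifting `k` by `σ` permutes the triplets, so this is the diagonal series for `(s', l')`.
    have hshift : Summable fun t : ℤ × ℤ × P =>
        ‖(inner ℂ (basisK K s' l' (t.1 + σ)) ((opT ^ t.2.1) (ψ t.2.2)) : ℂ)‖ ^ 2 :=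
      ((Equiv.addRight σ).prodCongr (Equiv.refl (ℤ × P))).summable_iff.2 (hdiag s' l')
    have hs : Summable (matrixTerm K ψ s s' l l' σ) := by
      refine ((hdiag s l).add hshift).of_norm_bounded fun t => ?_
      rw [matrixTerm, norm_mul, RCLike.norm_conj]
      -- `a * b ≤ a ^ 2 + b ^ 2` for the two coefficient norms.
      nlinarith [sq_nonneg (‖(inner ℂ (basisK K s l t.1) ((opT ^ t.2.1) (ψ t.2.2)) : ℂ)‖ -
        ‖(inner ℂ (basisK K s' l' (t.1 + σ)) ((opT ^ t.2.1) (ψ t.2.2)) : ℂ)‖)]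
    have hlim := ((Equiv.prodAssoc ℤ ℤ P).hasSum_iff.2 hs.hasSum).comp tendsto_finset_product_atTop
    exact tendsto_nhds_unique hlim (h s s' l l' σ) ▸ hs.hasSum

end WaveletCoefficients

end

theorem corollary10 {I J P : Type*} [DecidableEq J] [Countable P]
    (L : HilbertBasis I ℂ (L2On (Set.Ico 0 1)))
    (K : ∀ s : ℤˣ, HilbertBasis J ℂ (L2On (signedInterval s)))
    (ψ : P → L2R) (hψ : ∃ M : ℝ, ∀ p, ‖ψ p‖ ≤ M) (B : ℝ) (hB : 0 < B) :
    (∀ (s s' : ℤˣ) (l l' : J) (σ k j : ℤ) (p : P),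
      Summable fun q : (I × ℤ) × (I × ℤ) => alphaTerm L K s s' l l' σ k j q * hatTerm L (ψ p) q) ∧
    (IsTightFrame (waveletSystem ψ) B ↔
      ∀ (s s' : ℤˣ) (l l' : J) (σ : ℤ),
        Tendsto
          (fun F : Finset (ℤ × ℤ) × Finset P =>
            ∑' q : (I × ℤ) × (I × ℤ),
              (∑ t ∈ F.1, alphaTerm L K s s' l l' σ t.1 t.2 q) * (∑ p ∈ F.2, hatTerm L (ψ p) q))
          atTop (𝓝 (if s = s' ∧ l = l' ∧ σ = 0 then (B : ℂ) else 0))) ∧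
    (IsTightFrame (waveletSystem ψ) B ↔
      ∀ (s s' : ℤˣ) (l l' : J) (σ : ℤ),
        Tendsto
          (fun F : Finset (ℤ × ℤ × P) =>
            ∑' q : (I × ℤ) × (I × ℤ),
              ∑ t ∈ F, alphaTerm L K s s' l l' σ t.1 t.2.1 q * hatTerm L (ψ t.2.2) q)
          atTop (𝓝 (if s = s' ∧ l = l' ∧ σ = 0 then (B : ℂ) else 0))) := by
  refine ⟨fun s s' l l' σ k j p =>
    (hasSum_alphaTerm_mul_hatTerm L K ψ s s' l l' σ (k, j, p)).summable, ?_, ?_⟩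
  · simp only [tsum_sum_alphaTerm_mul_sum_hatTerm]
    rw [isTightFrame_waveletSystem_iff K ψ hB, hasSum_matrixTerm_iff_tendsto]
  · simp only [tsum_sum_alphaTerm_mul_hatTerm]
    exact isTightFrame_waveletSystem_iff K ψ hB
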